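/- Write $[B]=\{1,\dots,B\}$ and let $\log$ denote the logarithm to base 2. An $n$-user single-message shuffled-model protocol for frequency estimation on $[B]$ with message set $Y$ consists of a local randomizer $R$, assigning to every $x\in[B]$ a discrete probability distribution on $Y$, and a randomized analyzer $A: Y^n\to[0,1]^B$. On a dataset $X=(x_1,\dots,x_n)\in[B]^n$, messages $y_i\sim R(x_i)$ are drawn independently, $S(y_1,\dots,y_n)$ is the sequence $(y_1,\dots,y_n)$ in uniformly random order, and the output is $P(X)=A(S(y_1,\dots,y_n))$. The protocol is $(\varepsilon,\delta)$-differentially private if for all datasets $X,X'$ that, up to reordering, differ in at most one entry, and all $T\subseteq Y^n$, $\Pr[S(R(x_1),\dots,R(x_n))\in T]\le e^{\varepsilon}\Pr[S(R(x_1'),\dots,R(x_n'))\in T]+\delta$. It is $(\alpha,\beta)$-accurate if for every $X\in[B]^n$, with probability at least $1-\beta$, $\max_{j\in[B]}\bigl|P(X)_j-\tfrac1n|\{i:x_i=j\}|\bigr|\le\alpha$. **Theorem 3.2.** There are absolute constants $c,\kappa>0$ such that the following holds. Let $n,B\in\mathbb N$ with $n\ge 1/c$ and $B\ge2$, let $\varepsilon\ge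 0$ and $0\le\delta<c/n$. Then for every $(\varepsilon,\delta)$-differentially private $n$-user single-message shuffled-model protocol for frequency estimation on $[B]$ that is $(\alpha,1/4)$-accurate: 1. (small-sample regime) if $\varepsilon\le\log n$ and $\frac{\log B}{c\log\log B}\le n\le(\log^2B)(\log\log B)$, then $\alpha\ge\kappa\,\frac{\log B}{n\log\log B}$; 2. (intermediate-sample regime) if $\varepsilon\le1$ and $(\log^2B)(\log\log B)\le n\le\frac{B^2}{\log B}$, then $\alpha\ge\kappa\,\frac{1}{n^{3/4}(\log n)^{1/4}}$; 3. (large-sample regime) if $\varepsilon\le1$ and $n>\frac{B^2}{\log B}$, then $\alpha\ge\kappa\,\frac{\sqrt B}{n\sqrt{\log B}}$. -/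

import Mathlib

open MeasureTheory
open scoped ENNReal

/-- Product weights of `n` probability mass functions add up to one. -/
theorem tsum_prod_pmf_eq_one {Y : Type*} :
    ∀ (n : ℕ) (p : Fin n → PMF Y), ∑' y : Fin n → Y, ∏ i, p i (y i) = (1 : ℝ≥0∞)
  | 0, p => by
      rw [tsum_eq_single (default : Fin 0 → Y) (fun y hy => absurd (Subsingleton.elim y _) hy)]
      simp
  | n + 1, p => by
      rw [← (Fin.consEquiv (fun _ : Fin (n + 1) => Y)).tsum_eq, ENNReal.tsum_prod']
      simp only [Fin.consEquiv_apply, Fin.prod_univ_succ, Fin.cons_zero, Fin.cons_succ,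
        ENNReal.tsum_mul_left, tsum_prod_pmf_eq_one n (fun i => p i.succ), mul_one]
      exact (p 0).tsum_coe

/-- The joint law of independent draws, the `i`-th one from `p i`. -/
noncomputable def independentLaw {n : ℕ} {Y : Type*} (p : Fin n → PMF Y) : PMF (Fin n → Y) :=
  ⟨fun y => ∏ i, p i (y i), by
    rw [← tsum_prod_pmf_eq_one n p]
    exact ENNReal.summable.hasSum⟩

/-- The shuffler: output the messages in a uniformly random order. -/
noncomputable def shuffler {n : ℕ} {Y : Type*} (y : Fin n → Y) : PMF (Fin n → Y) :=
  (PMF.uniformOfFintype (Equiv.Perm (Fin n))).map (fun π => y ∘ π)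

/-- Two datasets are neighboring if, up to reordering, they agree except possibly in one entry. -/
def Neighboring {n : ℕ} {𝒳 : Type*} (X X' : Fin n → 𝒳) : Prop :=
  ∃ (σ τ : Equiv.Perm (Fin n)) (i : Fin n), ∀ j, j ≠ i → X (σ j) = X' (τ j)

/-- `(ε, δ)`-differential privacy of a randomized function `M` of an `n`-entry dataset. -/
def IsDP {n : ℕ} {𝒳 𝒵 : Type*} (ε δ : ℝ) (M : (Fin n → 𝒳) → PMF 𝒵) : Prop :=
  ∀ X X' : Fin n → 𝒳, Neighboring X X' → ∀ S : Set 𝒵,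
    (M X).toOuterMeasure S
      ≤ ENNReal.ofReal (Real.exp ε) * (M X').toOuterMeasure S + ENNReal.ofReal δ

/-- The frequency of item `j` in the dataset `X`, that is `(1 / n) ∑ i, (e_{X i})_j`. -/
noncomputable def frequency {n B : ℕ} (X : Fin n → Fin B) (j : Fin B) : ℝ :=
  (1 / (n : ℝ)) * ∑ i : Fin n, if j = X i then 1 else 0

/-- `(α, β)`-accuracy for frequency estimation of a randomized map from datasets to `[0,1]^B`,
given by its output laws: on every dataset, with probability at least `1 - β`, all `B` estimates
are within `α` of the true frequencies. -/
def IsAccurate {n B : ℕ} (α β : ℝ)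
    (P : (Fin n → Fin B) → Measure (Fin B → unitInterval)) : Prop :=
  ∀ X : Fin n → Fin B,
    ENNReal.ofReal (1 - β) ≤ P X {v | ∀ j : Fin B, |(v j : ℝ) - frequency X j| ≤ α}

/-- An `n`-user single-message shuffled-model protocol for frequency estimation on `B` items, with
messages in `Y`. The local randomizer sends one message; the analyzer may be randomized. The
shuffler is always the uniform one. -/
structure SingleMessageProtocol (n B : ℕ) (Y : Type*) where
  /-- The local randomizer, used by each user. -/
  randomizer : Fin B → PMF Y
  /-- The analyzer, which sees the shuffled messages. -/
  analyzer : (Fin n → Y) → ProbabilityMeasure (Fin B → unitInterval)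

namespace SingleMessageProtocol

variable {n B : ℕ} {Y : Type*}

/-- The law of the output `S(R(x_1), …, R(x_n))` of the shuffler. -/
noncomputable def shuffledMessages (P : SingleMessageProtocol n B Y) (X : Fin n → Fin B) :
    PMF (Fin n → Y) :=
  (independentLaw (fun i => P.randomizer (X i))).bind shuffler

/-- The law of the output `A(S(R(x_1), …, R(x_n)))` of the protocol. -/
noncomputable def output (P : SingleMessageProtocol n B Y) (X : Fin n → Fin B) :
    Measure (Fin B → unitInterval) :=
  Measure.sum (fun y => P.shuffledMessages X y • (P.analyzer y : Measure (Fin B → unitInterval)))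

/-- Differential privacy in the shuffled model: what the shuffler releases is private. -/
def IsShuffledDP (P : SingleMessageProtocol n B Y) (ε δ : ℝ) : Prop :=
  IsDP ε δ P.shuffledMessages

end SingleMessageProtocol

/-! Privacy makes message distributions overlap, and accuracy forbids too much overlap.

Privacy side. If a message set `T` has probability `p` under `x'`, then among `n` users all holding
`x'` someone lands in `T` with probability at most `n p`. Changing one user to `x` therefore shows
that each local randomizer is dominated by any other up to the factor `e ^ ε * n` and the additive
`δ` (`IsShuffledDP.randomizer_le`). Equivalently, `R(v)` shares mass at least `1 - δ` with `e ^ ε *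
n * R(u)`.

Accuracy side. Let `p` and `q` have common mass `θ`. Among `n` draws, each from `p` or `q`, about `n
θ` come from the common part and do not reveal which law was used. The number of draws from `p` is
then hidden by noise of order `√(n θ)`, so counting within `a` forces `n θ = O((a + 1) ^ 2)`
(`overlap_le_of_estimates_count`). This applies to `R(u)` against any mixture of the other `R(v)`.

For `ε ≤ 1`, take `m` items with `m ^ 2 ≤ n`. Truncate each `R(v)` at `e ^ ε * n * R(u)`; the
truncations have total mass at least `m (1 - δ)`. At each message their sum is at most the largest
one plus all pairwise minima. The largest is controlled by `n` times the overlap of `R(u)` with the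
uniform mixture, and the fewer than `n` pairs contribute overlaps of order `(n α + 1) ^ 2 / n`.
Hence `m = O((n α + 1) ^ 2)` (`card_le_error_sq`). Taking `m` near `√n` or near `min B √n` gives the
intermediate and large regimes.

The small regime is a packing argument (`items_le_pow`): planting `v` at `k > 2 n α` users gives
disjoint accurate events, each of probability at least `(e ^ ε * n) ^ (-k) / 2` under one fixed
dataset, so `B` is at most of order `(e ^ ε * n) ^ k`. -/

/-! ### Product sums, truncation by minima, and shuffling -/

/-- The sum over all tuples of a product of functions of the coordinates factorizes. -/
theorem ENNReal.tsum_pi_prod {Y : Type*} :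
    ∀ (n : ℕ) (f : Fin n → Y → ℝ≥0∞), ∑' y : Fin n → Y, ∏ i, f i (y i) = ∏ i, ∑' z, f i z
  | 0, f => by
      rw [tsum_eq_single (default : Fin 0 → Y) (fun y hy => absurd (Subsingleton.elim y _) hy)]
      simp
  | n + 1, f => by
      rw [← (Fin.consEquiv (fun _ : Fin (n + 1) => Y)).tsum_eq, ENNReal.tsum_prod']
      simp only [Fin.consEquiv_apply, Fin.prod_univ_succ, Fin.cons_zero, Fin.cons_succ,
        ENNReal.tsum_mul_left, ENNReal.tsum_pi_prod n (fun i => f i.succ), ENNReal.tsum_mul_right]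

/-- A bound `p S ≤ L * q S + d` on all sets bounds the mass of `p` above `L * q`. -/
theorem tsum_le_tsum_min_add {Y : Type*} (p q : Y → ℝ≥0∞) (L d : ℝ≥0∞)
    (h : ∀ S : Set Y, ∑' y, S.indicator p y ≤ L * ∑' y, S.indicator q y + d) :
    ∑' y, p y ≤ ∑' y, min (p y) (L * q y) + d := by
  -- The extremal test set: off `T` the minimum is `p` itself, so only the mass on `T` needs the
  -- hypothesis.
  set T : Set Y := {y | L * q y < p y} with hT
  have hmin : ∀ y, min (p y) (L * q y) = L * T.indicator q y + Tᶜ.indicator p y := by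
    intro y
    by_cases hy : y ∈ T
    · have : L * q y < p y := hy
      simp [hy, this.le]
    · have : p y ≤ L * q y := not_lt.mp hy
      simp [hy, this]
  have hsplit : ∀ y, p y = T.indicator p y + Tᶜ.indicator p y := fun y => by
    by_cases hy : y ∈ T <;> simp [hy]
  calc ∑' y, p y = ∑' y, T.indicator p y + ∑' y, Tᶜ.indicator p y := by
        rw [← ENNReal.tsum_add]; exact tsum_congr hsplit
    _ ≤ (L * ∑' y, T.indicator q y + d) + ∑' y, Tᶜ.indicator p y := by gcongr; exact h T
    _ = ∑' y, min (p y) (L * q y) + d := by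
        simp_rw [hmin]
        rw [ENNReal.tsum_add, ENNReal.tsum_mul_left]
        ring

/-- If `r ≤ p` and `g ≤ 1`, then replacing `p` by `r` in the expectation of `g` loses at most
the difference of the masses. -/
theorem tsum_mul_add_tsum_le {Y : Type*} (p r g : Y → ℝ≥0∞) (hr : ∀ y, r y ≤ p y)
    (hg : ∀ y, g y ≤ 1) :
    ∑' y, p y * g y + ∑' y, r y ≤ ∑' y, r y * g y + ∑' y, p y := by
  rw [← ENNReal.tsum_add, ← ENNReal.tsum_add]
  refine ENNReal.tsum_le_tsum fun y => ?_
  obtain ⟨d, hd⟩ := exists_add_of_le (hr y)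
  rw [hd, add_mul]
  calc r y * g y + d * g y + r y ≤ r y * g y + d * 1 + r y := by gcongr; exact hg y
    _ = r y * g y + (r y + d) := by ring

/-- Extends privacy from events to `[0,1]`-valued tests, which is what a randomized analyzer
produces: truncating `M X` at `e ^ ε * M X'` costs at most `δ` of mass. -/
theorem IsDP.tsum_mul_le {n : ℕ} {𝒳 𝒵 : Type*} {ε δ : ℝ} {M : (Fin n → 𝒳) → PMF 𝒵}
    (h : IsDP ε δ M) {X X' : Fin n → 𝒳} (hX : Neighboring X X') (g : 𝒵 → ℝ≥0∞)
    (hg : ∀ z, g z ≤ 1) :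
    ∑' z, M X z * g z
      ≤ ENNReal.ofReal (Real.exp ε) * ∑' z, M X' z * g z + ENNReal.ofReal δ := by
  have h1 := tsum_le_tsum_min_add (M X) (M X') (ENNReal.ofReal (Real.exp ε)) (ENNReal.ofReal δ)
    (fun S => by simpa only [PMF.toOuterMeasure_apply] using h X X' hX S)
  have h2 := tsum_mul_add_tsum_le (M X)
    (fun z => min (M X z) (ENNReal.ofReal (Real.exp ε) * M X' z)) g (fun z => min_le_left _ _) hg
  have hfin : ∑' z, min (M X z) (ENNReal.ofReal (Real.exp ε) * M X' z) ≠ ∞ :=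
    ne_top_of_le_ne_top (M X).tsum_coe_ne_top (ENNReal.tsum_le_tsum fun z => min_le_left _ _)
  have h3 : ∑' z, min (M X z) (ENNReal.ofReal (Real.exp ε) * M X' z) * g z
      ≤ ENNReal.ofReal (Real.exp ε) * ∑' z, M X' z * g z := by
    rw [← ENNReal.tsum_mul_left]
    refine ENNReal.tsum_le_tsum fun z => ?_
    rw [← mul_assoc]
    gcongr
    exact min_le_right _ _
  refine (ENNReal.add_le_add_iff_right hfin).mp ?_
  calc _ ≤ _ := h2
    _ ≤ _ := add_le_add h3 h1
    _ = _ := by ring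

theorem shuffler_toOuterMeasure_of_perm_invariant {n : ℕ} {Y : Type*} (E : Set (Fin n → Y))
    (hE : ∀ (π : Equiv.Perm (Fin n)) y, y ∘ π ∈ E ↔ y ∈ E) (y : Fin n → Y) :
    (shuffler y).toOuterMeasure E = E.indicator 1 y := by
  have hpre : (fun π : Equiv.Perm (Fin n) => y ∘ π) ⁻¹' E = {_π | y ∈ E} := by
    ext π; simp [hE]
  have hmap : shuffler y
      = (PMF.uniformOfFintype (Equiv.Perm (Fin n))).map (fun π : Equiv.Perm (Fin n) => y ∘ π) :=
    PMF.map_comp (fun π : Equiv.Perm (Fin n) => (π : Fin n → Fin n)) _ _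
  rw [hmap, PMF.toOuterMeasure_map_apply, hpre]
  by_cases hy : y ∈ E
  · simp only [hy, Set.ofPred_true, Set.indicator_of_mem, Pi.one_apply]
    rw [PMF.toOuterMeasure_apply_eq_one_iff]
    exact Set.subset_univ _
  · simp [hy]

/-! ### From shuffled privacy to privacy of the local randomizer -/

namespace SingleMessageProtocol

variable {n B : ℕ} {Y : Type*}

/-- The law of the output when the messages before shuffling are `y`. -/
noncomputable def outputGiven (P : SingleMessageProtocol n B Y) (y : Fin n → Y) :
    Measure (Fin B → unitInterval) :=
  Measure.sum fun z => shuffler y z • (P.analyzer z : Measure (Fin B → unitInterval))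

theorem outputGiven_univ (P : SingleMessageProtocol n B Y) (y : Fin n → Y) :
    P.outputGiven y Set.univ = 1 := by
  rw [outputGiven, Measure.sum_apply _ MeasurableSet.univ]
  simp

instance (P : SingleMessageProtocol n B Y) (y : Fin n → Y) :
    IsProbabilityMeasure (P.outputGiven y) := ⟨P.outputGiven_univ y⟩

/-- Shuffling is absorbed into the analyzer, leaving a product law for the messages. -/
theorem output_apply (P : SingleMessageProtocol n B Y) (X : Fin n → Fin B)
    {E : Set (Fin B → unitInterval)} (hE : MeasurableSet E) :
    P.output X E = ∑' y : Fin n → Y, (∏ i, P.randomizer (X i) (y i)) * P.outputGiven y E := by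
  simp only [output, outputGiven, Measure.sum_apply _ hE, Measure.smul_apply, smul_eq_mul,
    shuffledMessages, PMF.bind_apply, ← ENNReal.tsum_mul_left, ← ENNReal.tsum_mul_right]
  rw [ENNReal.tsum_comm]
  simp only [mul_assoc]
  rfl

theorem output_univ (P : SingleMessageProtocol n B Y) (X : Fin n → Fin B) :
    P.output X Set.univ = 1 := by
  rw [output_apply P X MeasurableSet.univ]
  simp only [outputGiven_univ, mul_one]
  exact tsum_prod_pmf_eq_one n _

theorem shuffledMessages_toOuterMeasure (P : SingleMessageProtocol n B Y) (X : Fin n → Fin B)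
    (E : Set (Fin n → Y)) (hE : ∀ (π : Equiv.Perm (Fin n)) y, y ∘ π ∈ E ↔ y ∈ E) :
    (P.shuffledMessages X).toOuterMeasure E
      = ∑' y : Fin n → Y, (∏ i, P.randomizer (X i) (y i)) * E.indicator 1 y := by
  rw [shuffledMessages, PMF.toOuterMeasure_bind_apply]
  refine tsum_congr fun y => ?_
  rw [shuffler_toOuterMeasure_of_perm_invariant E hE]
  rfl

theorem tsum_prod_mul_indicator_coord (P : SingleMessageProtocol n B Y) (X : Fin n → Fin B)
    (T : Set Y) (j : Fin n) :
    ∑' y : Fin n → Y, (∏ i, P.randomizer (X i) (y i)) * T.indicator 1 (y j)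
      = ∑' z, T.indicator (P.randomizer (X j)) z := by
  have h : ∀ y : Fin n → Y, (∏ i, P.randomizer (X i) (y i)) * T.indicator 1 (y j)
      = ∏ i, (if i = j then T.indicator (P.randomizer (X i)) (y i)
          else P.randomizer (X i) (y i)) := by
    intro y
    rw [← Finset.mul_prod_erase Finset.univ _ (Finset.mem_univ j),
      ← Finset.mul_prod_erase Finset.univ (fun i => ite _ _ _) (Finset.mem_univ j), if_pos rfl,
      Finset.prod_congr rfl (fun i hi => if_neg (Finset.ne_of_mem_erase hi))]
    by_cases hj : y j ∈ T <;> simp [hj]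
  rw [tsum_congr h, ENNReal.tsum_pi_prod n
    (fun i z => if i = j then T.indicator (P.randomizer (X i)) z else P.randomizer (X i) z),
    ← Finset.mul_prod_erase Finset.univ _ (Finset.mem_univ j),
    Finset.prod_eq_one (fun i hi => ?_)]
  · simp
  · simp [Finset.ne_of_mem_erase hi]

/-- A shuffled-model private protocol has a local randomizer that is private with `e ^ ε` replaced
by `n * e ^ ε`. -/
theorem IsShuffledDP.randomizer_le {P : SingleMessageProtocol n B Y} {ε δ : ℝ}
    (h : P.IsShuffledDP ε δ) (hn : 0 < n) (x x' : Fin B) (T : Set Y) :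
    ∑' y, T.indicator (P.randomizer x) y ≤ ENNReal.ofReal (Real.exp ε) * n *
      ∑' y, T.indicator (P.randomizer x') y + ENNReal.ofReal δ := by
  classical
  set i₀ : Fin n := ⟨0, hn⟩
  set X' : Fin n → Fin B := fun _ => x'
  set X : Fin n → Fin B := Function.update X' i₀ x
  -- A permutation-invariant event, so the shuffler does not affect it; the union bound over users
  -- is the source of the factor `n`.
  set E : Set (Fin n → Y) := {y | ∃ i, y i ∈ T}
  have hE : ∀ (π : Equiv.Perm (Fin n)) y, y ∘ π ∈ E ↔ y ∈ E := fun π y =>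
    ⟨fun ⟨i, hi⟩ => ⟨π i, hi⟩, fun ⟨i, hi⟩ => ⟨π.symm i, by simpa using hi⟩⟩
  have hX : Neighboring X X' := ⟨1, 1, i₀, fun j hj => by simp [X, hj]⟩
  have hdp := h X X' hX E
  rw [shuffledMessages_toOuterMeasure P X E hE, shuffledMessages_toOuterMeasure P X' E hE] at hdp
  have hlow : ∑' y, T.indicator (P.randomizer x) y
      ≤ ∑' y : Fin n → Y, (∏ i, P.randomizer (X i) (y i)) * E.indicator 1 y := by
    have := tsum_prod_mul_indicator_coord P X T i₀
    simp only [X, Function.update_self] at this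
    rw [← this]
    refine ENNReal.tsum_le_tsum fun y => ?_
    gcongr
    by_cases hy : y i₀ ∈ T
    · have : y ∈ E := ⟨i₀, hy⟩
      simp [hy, this]
    · simp [hy]
  have hup : ∑' y : Fin n → Y, (∏ i, P.randomizer (X' i) (y i)) * E.indicator 1 y
      ≤ n * ∑' y, T.indicator (P.randomizer x') y := by
    calc _ ≤ ∑' y : Fin n → Y,
          ∑ j, (∏ i, P.randomizer (X' i) (y i)) * T.indicator 1 (y j) := by
          refine ENNReal.tsum_le_tsum fun y => ?_
          rw [← Finset.mul_sum]
          gcongr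
          by_cases hy : y ∈ E
          · obtain ⟨i, hi⟩ := hy
            calc E.indicator 1 y ≤ (1 : ℝ≥0∞) := Set.indicator_le_self' (by simp) y
              _ = T.indicator 1 (y i) := by simp [hi]
              _ ≤ _ := Finset.single_le_sum (f := fun j => T.indicator (1 : Y → ℝ≥0∞) (y j))
                (fun _ _ => zero_le) (Finset.mem_univ i)
          · simp [hy]
      _ = _ := by
          rw [Summable.tsum_finsetSum fun _ _ => ENNReal.summable]
          simp [tsum_prod_mul_indicator_coord, X']
  calc _ ≤ _ := hlow
    _ ≤ _ := hdp
    _ ≤ _ := by rw [mul_assoc]; gcongr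

theorem IsShuffledDP.one_le_tsum_min_add {P : SingleMessageProtocol n B Y} {ε δ : ℝ}
    (h : P.IsShuffledDP ε δ) (hn : 0 < n) (x x' : Fin B) :
    1 ≤ ∑' y, min (P.randomizer x y) (ENNReal.ofReal (Real.exp ε) * n * P.randomizer x' y)
      + ENNReal.ofReal δ := by
  rw [← (P.randomizer x).tsum_coe]
  exact tsum_le_tsum_min_add _ _ _ _ (h.randomizer_le hn x x')

end SingleMessageProtocol

/-! ### Anticoncentration of coin counts -/

theorem Nat.centralBinom_sq_mul_le (m : ℕ) : m.centralBinom ^ 2 * (2 * m + 1) ≤ 16 ^ m := by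
  induction m with
  | zero => simp
  | succ m ih =>
    have h := Nat.succ_mul_centralBinom_succ m
    refine Nat.le_of_mul_le_mul_left ?_ (show 0 < (m + 1) ^ 2 by positivity)
    calc (m + 1) ^ 2 * ((m + 1).centralBinom ^ 2 * (2 * (m + 1) + 1))
        = ((m + 1) * (m + 1).centralBinom) ^ 2 * (2 * m + 3) := by ring
      _ = (4 * ((2 * m + 1) * (2 * m + 3))) * (m.centralBinom ^ 2 * (2 * m + 1)) := by
          rw [h]; ring
      _ ≤ (16 * (m + 1) ^ 2) * 16 ^ m := by
          refine Nat.mul_le_mul ?_ ih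
          -- This is `(2m + 1)(2m + 3) ≤ 4 (m + 1) ^ 2`, the reason the factor `2m + 1` survives the
          -- induction.
          nlinarith
      _ = (m + 1) ^ 2 * 16 ^ (m + 1) := by ring

theorem Nat.choose_half_sq_mul_le (s : ℕ) : s.choose (s / 2) ^ 2 * s ≤ 4 ^ s := by
  rcases Nat.even_or_odd' s with ⟨m, rfl | rfl⟩
  · have h := Nat.centralBinom_sq_mul_le m
    rw [Nat.centralBinom] at h
    rw [Nat.mul_div_cancel_left m two_pos, pow_mul]
    exact (Nat.mul_le_mul_left _ (Nat.le_succ _)).trans h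
  · have h := Nat.centralBinom_sq_mul_le (m + 1)
    have h2 : (m + 1).centralBinom = 2 * (2 * m + 1).choose m := by
      rw [Nat.centralBinom, show 2 * (m + 1) = (2 * m + 1) + 1 by ring, Nat.choose_succ_succ,
        ← Nat.choose_symm_half]
      ring
    have h3 : (2 * m + 1) / 2 = m := by omega
    rw [h2] at h
    rw [h3]
    have h4 : (4 : ℕ) ^ (2 * m + 1) = 4 * 16 ^ m := by rw [pow_succ, pow_mul]; norm_num; ring
    rw [pow_succ 16 m] at h
    nlinarith [sq_nonneg ((2 * m + 1).choose m)]

/-- A real interval of radius `a` contains at most `2 a + 1` natural numbers. -/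
theorem Finset.card_le_of_abs_sub_le {F : Finset ℕ} {t a : ℝ}
    (hF : ∀ j ∈ F, |(j : ℝ) - t| ≤ a) (ha : 0 ≤ a) : (F.card : ℝ) ≤ 2 * a + 1 := by
  rcases F.eq_empty_or_nonempty with rfl | hne
  · simp; positivity
  have hsub : F ⊆ Finset.Icc (F.min' hne) (F.max' hne) := fun j hj =>
    Finset.mem_Icc.mpr ⟨F.min'_le j hj, F.le_max' j hj⟩
  have h1 := Finset.card_le_card hsub
  rw [Nat.card_Icc] at h1
  have h2 := abs_le.mp (hF _ (F.min'_mem hne))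
  have h3 := abs_le.mp (hF _ (F.max'_mem hne))
  have h4 : F.min' hne ≤ F.max' hne := F.min'_le _ (F.max'_mem hne)
  have h5 : (F.card : ℝ) + F.min' hne ≤ F.max' hne + 1 := by
    exact_mod_cast (by omega : F.card + F.min' hne ≤ F.max' hne + 1)
  linarith

/-- The number of `true` bits. -/
def numTrue {ι : Type*} [Fintype ι] (b : ι → Bool) : ℕ := ∑ i, if b i then 1 else 0

theorem numTrue_eq_card {ι : Type*} [Fintype ι] (b : ι → Bool) :
    numTrue b = (Finset.univ.filter fun i => b i = true).card := by
  simp [numTrue]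

theorem card_numTrue_eq {ι : Type*} [Fintype ι] [DecidableEq ι] (k : ℕ) :
    (Finset.univ.filter fun b : ι → Bool => numTrue b = k).card = (Fintype.card ι).choose k := by
  rw [← Finset.card_univ, ← Finset.card_powersetCard]
  refine Finset.card_bij' (fun b _ => Finset.univ.filter fun i => b i = true)
    (fun s _ i => decide (i ∈ s)) ?_ ?_ ?_ ?_
  · intro b hb
    simpa [Finset.mem_powersetCard, numTrue_eq_card] using hb
  · intro s hs
    simpa [Finset.mem_powersetCard, numTrue_eq_card] using hs
  · intro b hb; ext i; simp
  · intro s hs; ext i; simp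

/-- Anticoncentration of the number of heads among fair coins. -/
theorem card_numTrue_near_le {ι : Type*} [Fintype ι] [DecidableEq ι] (t a : ℝ) (ha : 0 ≤ a) :
    ((Finset.univ.filter fun b : ι → Bool => |(numTrue b : ℝ) - t| ≤ a).card : ℝ)
      * √(Fintype.card ι) ≤ (2 * a + 1) * 2 ^ (Fintype.card ι) := by
  set s := Fintype.card ι
  set G := Finset.univ.filter fun b : ι → Bool => |(numTrue b : ℝ) - t| ≤ a with hG
  -- Each value of the count is attained by at most the middle binomial coefficient of bit vectors,
  -- and the window holds at most `2a + 1` values.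
  have h1 : G.card ≤ (G.image numTrue).card * s.choose (s / 2) := by
    rw [mul_comm]
    refine Finset.card_le_mul_card_image G _ fun k _ => ?_
    calc _ ≤ (Finset.univ.filter fun b : ι → Bool => numTrue b = k).card :=
          Finset.card_le_card (Finset.filter_subset_filter _ (Finset.subset_univ _))
      _ = s.choose k := card_numTrue_eq k
      _ ≤ _ := Nat.choose_le_middle k s
  have h2 : ((G.image numTrue).card : ℝ) ≤ 2 * a + 1 := by
    refine Finset.card_le_of_abs_sub_le (t := t) (fun j hj => ?_) ha
    obtain ⟨b, hb, rfl⟩ := Finset.mem_image.mp hj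
    exact (Finset.mem_filter.mp hb).2
  have h3 : (s.choose (s / 2) : ℝ) * √s ≤ 2 ^ s := by
    refine abs_le_of_sq_le_sq' ?_ (by positivity) |>.2
    rw [mul_pow, Real.sq_sqrt (Nat.cast_nonneg s), ← pow_mul, mul_comm s 2, pow_mul]
    norm_num
    exact_mod_cast Nat.choose_half_sq_mul_le s
  calc (G.card : ℝ) * √s ≤ ((G.image numTrue).card * s.choose (s / 2) : ℝ) * √s := by
        gcongr; exact_mod_cast h1
    _ = (G.image numTrue).card * (s.choose (s / 2) * √s) := by ring
    _ ≤ _ := by gcongr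

/-- Anticoncentration of the number of `true` bits, for weights that do not depend on the bits
in `S`. -/
theorem sum_mul_indicator_numTrue_le {n : ℕ} (S : Finset (Fin n)) (g : (Fin n → Bool) → ℝ≥0∞)
    (hg : ∀ b b' : Fin n → Bool, (∀ i ∉ S, b i = b' i) → g b = g b') (t a : ℝ) (ha : 0 ≤ a)
    (hS : 0 < S.card) :
    ∑ b, (if |(numTrue b : ℝ) - t| ≤ a then g b else 0)
      ≤ ENNReal.ofReal ((2 * a + 1) / √S.card) * ∑ b, g b := by
  -- Condition on the bits outside `S`: they only shift the centre of the window, and `g` is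
  -- constant on each fibre.
  set e := Equiv.piEquivPiSubtypeProd (fun i => i ∈ S) (fun _ : Fin n => Bool)
  have hnum : ∀ c d, numTrue (e.symm (c, d)) = numTrue c + numTrue d := by
    intro c d
    rw [numTrue, ← Fintype.sum_subtype_add_sum_subtype (fun i => i ∈ S), numTrue, numTrue]
    congr 1 <;> refine Finset.sum_congr (by ext; simp) fun i _ => ?_ <;>
      simp [e, Equiv.piEquivPiSubtypeProd, i.2]
  have hg' : ∀ c c' d, g (e.symm (c, d)) = g (e.symm (c', d)) := by
    intro c c' d
    refine hg _ _ fun i hi => ?_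
    simp [e, Equiv.piEquivPiSubtypeProd, hi]
  have hsum : ∀ f : (Fin n → Bool) → ℝ≥0∞, ∑ b, f b = ∑ d, ∑ c, f (e.symm (c, d)) := by
    intro f
    rw [← e.symm.sum_comp, Fintype.sum_prod_type_right]
  rw [hsum, hsum, Finset.mul_sum]
  refine Finset.sum_le_sum fun d _ => ?_
  set c₀ : (i : {i // i ∈ S}) → Bool := fun _ => false
  have h1 : ∑ c, g (e.symm (c, d)) = 2 ^ S.card * g (e.symm (c₀, d)) := by
    rw [Finset.sum_congr rfl (fun c _ => hg' c c₀ d)]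
    simp
  have h2 : ∑ c, (if |(numTrue (e.symm (c, d)) : ℝ) - t| ≤ a then g (e.symm (c, d)) else 0)
      = (Finset.univ.filter fun c : {i // i ∈ S} → Bool =>
          |(numTrue c : ℝ) - (t - numTrue d)| ≤ a).card * g (e.symm (c₀, d)) := by
    rw [← nsmul_eq_mul, ← Finset.sum_const, Finset.sum_filter]
    refine Finset.sum_congr rfl fun c _ => ?_
    rw [hnum, hg' c c₀ d, Nat.cast_add, sub_sub_eq_add_sub]
  rw [h1, h2, ← mul_assoc]
  gcongr
  have h3 := card_numTrue_near_le (ι := {i // i ∈ S}) (t - numTrue d) a ha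
  rw [Fintype.card_coe] at h3
  have h4 : (0 : ℝ) < √S.card := Real.sqrt_pos.mpr (by exact_mod_cast hS)
  rw [← ENNReal.ofReal_natCast, show (2 : ℝ≥0∞) ^ S.card = ENNReal.ofReal (2 ^ S.card) by
    rw [ENNReal.ofReal_pow zero_le_two]; simp, ← ENNReal.ofReal_mul (by positivity)]
  refine ENNReal.ofReal_le_ofReal ?_
  rw [div_mul_eq_mul_div, le_div_iff₀ h4]
  exact h3

/-! ### Accuracy bounds overlaps -/

/-- The overlap of two distributions limits how well one can count the draws from one of them
among `n` draws. -/
theorem overlap_le_of_estimates_count {n : ℕ} {Y Ω : Type*} [MeasurableSpace Ω]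
    (p q : Y → ℝ≥0∞) (hp : ∑' y, p y = 1) (hq : ∑' y, q y = 1)
    (ν : (Fin n → Y) → Measure Ω) [∀ y, IsProbabilityMeasure (ν y)] (est : Ω → ℝ)
    (hest : Measurable est) (a : ℝ) (ha : 0 ≤ a)
    (hacc : ∀ b : Fin n → Bool, ENNReal.ofReal (3 / 4)
      ≤ ∑' y : Fin n → Y, (∏ i, if b i then p (y i) else q (y i)) *
          ν y {ω | |(numTrue b : ℝ) - est ω| ≤ a}) :
    n * ∑' y, min (p y) (q y) ≤ ENNReal.ofReal (64 * (a + 1) ^ 2) := by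
  set m : Y → ℝ≥0∞ := fun y => min (p y) (q y) with hm
  set e : Bool → Y → ℝ≥0∞ := fun b y => (if b then p y else q y) - m y with he
  have hpq : ∀ b y, (if b = true then p y else q y) = m y + e b y := by
    intro b y
    rw [he, add_tsub_cancel_of_le]
    cases b
    · exact min_le_right (p y) (q y)
    · exact min_le_left (p y) (q y)
  have hmass : ∀ b, ∑' y, m y + ∑' y, e b y = 1 := by
    intro b
    rw [← ENNReal.tsum_add, tsum_congr fun y => (hpq b y).symm]
    cases b <;> simpa
  have hm1 : ∑' y, m y ≤ 1 := by rw [← hmass true]; exact le_self_add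
  have hmtop : ∑' y, m y ≠ ∞ := ne_top_of_le_ne_top ENNReal.one_ne_top hm1
  obtain ⟨θ, hθ⟩ : ∃ θ : ℝ, θ = (∑' y, m y).toReal := ⟨_, rfl⟩
  have hθ0 : 0 ≤ θ := hθ ▸ ENNReal.toReal_nonneg
  have hθm : ∑' y, m y = ENNReal.ofReal θ := by rw [hθ, ENNReal.ofReal_toReal hmtop]
  have hθ1 : θ ≤ 1 := by rw [hθ]; exact ENNReal.toReal_le_of_le_ofReal zero_le_one (by simpa)
  have heθ : ∀ b, ∑' y, e b y = ENNReal.ofReal (1 - θ) := by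
    intro b
    rw [ENNReal.ofReal_sub _ hθ0, ENNReal.ofReal_one, ← hθm, ← hmass b,
      ENNReal.add_sub_cancel_left hmtop]
  rw [hθm, ← ENNReal.ofReal_natCast, ← ENNReal.ofReal_mul (Nat.cast_nonneg n)]
  refine ENNReal.ofReal_le_ofReal ?_
  by_contra! hbig
  have hnθ : 0 < n * θ := lt_trans (by positivity) hbig
  -- A quarter of the expected number of draws from the common part.
  set r : ℝ := n * θ / 4 with hr
  have hr0 : 0 < r := by positivity
  -- the weight of choosing the common part exactly on `S`
  set W : Finset (Fin n) → (Fin n → Bool) → (Fin n → Y) → ℝ≥0∞ :=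
    fun S b y => ∏ i, if i ∈ S then m (y i) else e (b i) (y i) with hW
  -- The first term is anticoncentration when `S.card ≥ r`; the second exceeds 1 when `S.card < r`,
  -- making the bound trivial there. Its exponential form lets the sum over `S` be evaluated by the
  -- binomial theorem, as in a Chernoff bound.
  set κ : Finset (Fin n) → ℝ := fun S => (2 * a + 1) / √r + 2 ^ (r - S.card) with hκ
  have hκ0 : ∀ S, 0 ≤ κ S := fun S => by positivity
  have hexpand : ∀ (b : Fin n → Bool) (y : Fin n → Y),
      (∏ i, if b i then p (y i) else q (y i)) = ∑ S : Finset (Fin n), W S b y := by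
    intro b y
    simp only [hpq, Finset.prod_add, Finset.powerset_univ, hW]
    refine Finset.sum_congr rfl fun S _ => ?_
    rw [Finset.prod_ite]
    congr 1
    · refine Finset.prod_congr ?_ fun _ _ => rfl
      ext; simp
    · refine Finset.prod_congr ?_ fun _ _ => rfl
      ext; simp
  have hWsum : ∀ S b, ∑' y, W S b y
      = ENNReal.ofReal (θ ^ S.card * (1 - θ) ^ (n - S.card)) := by
    intro S b
    rw [hW]
    have := ENNReal.tsum_pi_prod n (fun i z => if i ∈ S then m z else e (b i) z)
    simp only at this ⊢
    rw [this]
    have h2 : ∀ i, ∑' z, (if i ∈ S then m z else e (b i) z)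
        = if i ∈ S then ENNReal.ofReal θ else ENNReal.ofReal (1 - θ) := by
      intro i
      split_ifs
      · exact hθm
      · exact heθ _
    rw [Finset.prod_congr rfl fun i _ => h2 i, Finset.prod_ite, Finset.prod_const,
      Finset.prod_const, ENNReal.ofReal_mul (by positivity), ENNReal.ofReal_pow hθ0,
      ENNReal.ofReal_pow (by linarith), Finset.filter_not]
    simp [Finset.card_sdiff]
  -- Given `y`, the estimate `t` cannot depend on `b`, and on `S` the weight does not depend on `b`
  -- either.
  have hwindow : ∀ S (y : Fin n → Y) (t : ℝ),
      ∑ b, (if |(numTrue b : ℝ) - t| ≤ a then W S b y else 0)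
        ≤ ENNReal.ofReal (κ S) * ∑ b, W S b y := by
    intro S y t
    rcases lt_or_ge (S.card : ℝ) r with hlt | hge
    · have h1 : 1 ≤ κ S := by
        have : (1 : ℝ) ≤ 2 ^ (r - S.card) := Real.one_le_rpow one_le_two (by linarith)
        have h2 : 0 ≤ (2 * a + 1) / √r := by positivity
        rw [hκ]; linarith
      calc _ ≤ ∑ b, W S b y := Finset.sum_le_sum fun b _ => by split_ifs <;> simp
        _ = 1 * ∑ b, W S b y := (one_mul _).symm
        _ ≤ _ := by
          gcongr
          rwa [ENNReal.one_le_ofReal]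
    · have hS : 0 < S.card := by exact_mod_cast hr0.trans_le hge
      refine (sum_mul_indicator_numTrue_le S (fun b => W S b y) ?_ t a ha hS).trans ?_
      · intro b b' hbb
        refine Finset.prod_congr rfl fun i _ => ?_
        by_cases hi : i ∈ S
        · simp [hi]
        · simp [hi, hbb i hi]
      · gcongr
        calc (2 * a + 1) / √S.card ≤ (2 * a + 1) / √r := by gcongr
          _ ≤ κ S := by rw [hκ]; simp; positivity
  have hmeas : ∀ b : Fin n → Bool, MeasurableSet {ω | |(numTrue b : ℝ) - est ω| ≤ a} := fun b =>
    measurableSet_le ((measurable_const.sub hest).abs) measurable_const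
  have hSy : ∀ S (y : Fin n → Y), ∑ b, W S b y * ν y {ω | |(numTrue b : ℝ) - est ω| ≤ a}
      ≤ ENNReal.ofReal (κ S) * ∑ b, W S b y := by
    intro S y
    calc _ = ∫⁻ ω, ∑ b, (if |(numTrue b : ℝ) - est ω| ≤ a then W S b y else 0) ∂(ν y) := by
          rw [lintegral_finsetSum _ fun b _ =>
            Measurable.ite (hmeas b) measurable_const measurable_const]
          refine Finset.sum_congr rfl fun b _ => ?_
          rw [← lintegral_indicator_const (hmeas b)]
          rfl
      _ ≤ ∫⁻ _, ENNReal.ofReal (κ S) * ∑ b, W S b y ∂(ν y) :=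
          lintegral_mono fun ω => hwindow S y (est ω)
      _ = _ := by simp
  have hmain : ENNReal.ofReal (3 / 4) * 2 ^ n ≤ ENNReal.ofReal
      (2 ^ n * ∑ S : Finset (Fin n), κ S * (θ ^ S.card * (1 - θ) ^ (n - S.card))) := by
    calc ENNReal.ofReal (3 / 4) * 2 ^ n = ∑ _b : Fin n → Bool, ENNReal.ofReal (3 / 4) := by
          simp [mul_comm]
      _ ≤ ∑ b : Fin n → Bool, ∑' y : Fin n → Y, ∑ S, W S b y *
            ν y {ω | |(numTrue b : ℝ) - est ω| ≤ a} := by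
          refine Finset.sum_le_sum fun b _ => (hacc b).trans_eq ?_
          simp only [hexpand, Finset.sum_mul]
      _ = ∑ S, ∑' y : Fin n → Y, ∑ b, W S b y *
            ν y {ω | |(numTrue b : ℝ) - est ω| ≤ a} := by
          simp only [Summable.tsum_finsetSum fun _ _ => ENNReal.summable]
          exact Finset.sum_comm
      _ ≤ ∑ S, ∑' y : Fin n → Y, ENNReal.ofReal (κ S) * ∑ b, W S b y :=
          Finset.sum_le_sum fun S _ => ENNReal.tsum_le_tsum fun y => hSy S y
      _ = ∑ S : Finset (Fin n), ENNReal.ofReal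
            (2 ^ n * (κ S * (θ ^ S.card * (1 - θ) ^ (n - S.card)))) := by
          refine Finset.sum_congr rfl fun S _ => ?_
          rw [ENNReal.tsum_mul_left, Summable.tsum_finsetSum fun _ _ => ENNReal.summable]
          simp only [hWsum, Finset.sum_const, Finset.card_univ, Fintype.card_pi, Fintype.card_bool,
            Finset.prod_const, Fintype.card_fin, nsmul_eq_mul, Nat.cast_pow, Nat.cast_ofNat]
          rw [ENNReal.ofReal_mul (p := 2 ^ n) (by positivity), ENNReal.ofReal_mul (hκ0 S),
            ENNReal.ofReal_pow zero_le_two, ENNReal.ofReal_ofNat]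
          ring
      _ = _ := by
          rw [Finset.mul_sum, ENNReal.ofReal_sum_of_nonneg]
          intro S _
          have := hκ0 S
          have : 0 ≤ 1 - θ := by linarith
          positivity
  have hreal : 3 / 4 ≤ ∑ S : Finset (Fin n), κ S * (θ ^ S.card * (1 - θ) ^ (n - S.card)) := by
    have h2 : (2 : ℝ≥0∞) ^ n = ENNReal.ofReal (2 ^ n) := by
      rw [ENNReal.ofReal_pow zero_le_two]; simp
    have hnn : 0 ≤ ∑ S : Finset (Fin n), κ S * (θ ^ S.card * (1 - θ) ^ (n - S.card)) := by
      refine Finset.sum_nonneg fun S _ => ?_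
      have := hκ0 S
      have : 0 ≤ 1 - θ := by linarith
      positivity
    rw [h2, ← ENNReal.ofReal_mul (by norm_num), ENNReal.ofReal_le_ofReal_iff (by positivity),
      mul_comm] at hmain
    exact le_of_mul_le_mul_left hmain (by positivity)
  have hbinom : ∀ x : ℝ, ∑ S : Finset (Fin n), x ^ S.card * (1 - θ) ^ (n - S.card)
      = (x + (1 - θ)) ^ n := by
    intro x
    simpa using (Finset.sum_pow_mul_eq_add_pow x (1 - θ) (Finset.univ : Finset (Fin n)))
  have hsum : ∑ S : Finset (Fin n), κ S * (θ ^ S.card * (1 - θ) ^ (n - S.card))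
      = (2 * a + 1) / √r + 2 ^ r * (1 - θ / 2) ^ n := by
    have h1 : ∀ S : Finset (Fin n), κ S * (θ ^ S.card * (1 - θ) ^ (n - S.card))
        = (2 * a + 1) / √r * (θ ^ S.card * (1 - θ) ^ (n - S.card))
          + 2 ^ r * ((θ / 2) ^ S.card * (1 - θ) ^ (n - S.card)) := by
      intro S
      rw [hκ, div_pow]
      simp only [Real.rpow_sub zero_lt_two, Real.rpow_natCast]
      ring
    rw [Finset.sum_congr rfl fun S _ => h1 S, Finset.sum_add_distrib, ← Finset.mul_sum,
      ← Finset.mul_sum, hbinom, hbinom]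
    ring
  have hexp : 2 ^ r * (1 - θ / 2) ^ n ≤ Real.exp (-r) := by
    have h1 : (2 : ℝ) ^ r ≤ Real.exp r := by
      rw [← Real.exp_one_rpow]
      gcongr
      linarith [Real.add_one_le_exp 1]
    have h2 : (1 - θ / 2) ^ n ≤ Real.exp (-(2 * r)) := by
      have : 1 - θ / 2 ≤ Real.exp (-(θ / 2)) := by linarith [Real.add_one_le_exp (-(θ / 2))]
      calc (1 - θ / 2) ^ n ≤ Real.exp (-(θ / 2)) ^ n := by gcongr; linarith
        _ = Real.exp (-(2 * r)) := by rw [← Real.exp_nat_mul, hr]; ring_nf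
    have h3 : 0 ≤ 1 - θ / 2 := by linarith
    calc 2 ^ r * (1 - θ / 2) ^ n ≤ Real.exp r * Real.exp (-(2 * r)) := by gcongr
      _ = Real.exp (-r) := by rw [← Real.exp_add]; ring_nf
  -- With `r` this large the two terms stay below `1/2` and `1/4`, contradicting the success
  -- probability `3/4`.
  have hr16 : 16 * (a + 1) ^ 2 < r := by rw [hr]; linarith
  have hsmall : Real.exp (-r) < 1 / 4 := by
    rw [Real.exp_neg, inv_lt_comm₀ (Real.exp_pos r) (by norm_num)]
    nlinarith [Real.add_one_le_exp r]
  have hsq : (2 * a + 1) / √r < 1 / 2 := by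
    have : 4 * (a + 1) < √r := Real.lt_sqrt_of_sq_lt (by nlinarith)
    rw [div_lt_iff₀ (by positivity)]
    linarith
  linarith

theorem measurableSet_accurate {n B : ℕ} (α : ℝ) (X : Fin n → Fin B) :
    MeasurableSet {v : Fin B → unitInterval | ∀ j : Fin B, |(v j : ℝ) - frequency X j| ≤ α} := by
  simp only [Set.ofPred_forall]
  refine MeasurableSet.iInter fun j => measurableSet_le ?_ measurable_const
  exact ((measurable_subtype_coe.comp (measurable_pi_apply j)).sub measurable_const).abs

theorem IsAccurate.nonneg {n B : ℕ} {α : ℝ} {Q : (Fin n → Fin B) → Measure (Fin B → unitInterval)}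
    (h : IsAccurate α (1 / 4) Q) (u : Fin B) : 0 ≤ α := by
  by_contra! hα
  have := h fun _ => u
  rw [show {v : Fin B → unitInterval | ∀ j, |(v j : ℝ) - frequency (fun _ : Fin n => u) j| ≤ α} = ∅
    from Set.eq_empty_of_forall_notMem fun v hv => by
      linarith [hv u, abs_nonneg ((v u : ℝ) - frequency (fun _ : Fin n => u) u)]] at this
  norm_num at this

/-- Two datasets that are far apart in some frequency are accurately answered by disjoint sets. -/
theorem disjoint_accurate {n B : ℕ} {α : ℝ} {X X' : Fin n → Fin B}
    (h : ∃ j, 2 * α < |frequency X j - frequency X' j|) :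
    Disjoint {v : Fin B → unitInterval | ∀ j : Fin B, |(v j : ℝ) - frequency X j| ≤ α}
      {v : Fin B → unitInterval | ∀ j : Fin B, |(v j : ℝ) - frequency X' j| ≤ α} := by
  obtain ⟨j, hj⟩ := h
  refine Set.disjoint_left.mpr fun v hv hv' => ?_
  have h1 := hv j
  have h2 := hv' j
  have h3 := abs_sub_le (frequency X j) (v j : ℝ) (frequency X' j)
  rw [abs_sub_comm (frequency X j) (v j : ℝ)] at h3
  linarith

namespace SingleMessageProtocol

variable {n B : ℕ} {Y : Type*}

/-- Accuracy bounds the overlap of the messages of an item with those of a mixture of others. -/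
theorem overlap_mixture_le {P : SingleMessageProtocol n B Y} {α : ℝ}
    (hacc : IsAccurate α (1 / 4) P.output) (hn : 0 < n) (u : Fin B) (w : Fin B → ℝ≥0∞)
    (hwu : w u = 0) (hw : ∑ v, w v = 1) :
    n * ∑' y, min (P.randomizer u y) (∑ v, w v * P.randomizer v y)
      ≤ ENNReal.ofReal (64 * (n * α + 1) ^ 2) := by
  have hα : 0 ≤ α := hacc.nonneg u
  have hn' : (0 : ℝ) < n := by exact_mod_cast hn
  have hest : Measurable fun ω : Fin B → unitInterval => (n : ℝ) * (ω u : ℝ) :=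
    (measurable_subtype_coe.comp (measurable_pi_apply u)).const_mul _
  refine overlap_le_of_estimates_count (P.randomizer u) (fun y => ∑ v, w v * P.randomizer v y)
    (P.randomizer u).tsum_coe ?_ P.outputGiven (fun ω => n * (ω u : ℝ)) hest (n * α)
    (by positivity) fun b => ?_
  · rw [Summable.tsum_finsetSum fun _ _ => ENNReal.summable]
    simpa [ENNReal.tsum_mul_left] using hw
  set E : Set (Fin B → unitInterval) := {ω | |(numTrue b : ℝ) - n * (ω u : ℝ)| ≤ n * α} with hE
  have hEm : MeasurableSet E := measurableSet_le (measurable_const.sub hest).abs measurable_const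
  set X : (Fin n → Fin B) → Fin n → Fin B := fun t i => if b i then u else t i with hX
  have hone : ∑ t : Fin n → Fin B, ∏ i, w (t i) = 1 := by
    have := Finset.prod_univ_sum (fun _ : Fin n => (Finset.univ : Finset (Fin B))) (fun _ => w)
    rw [Fintype.piFinset_univ] at this
    rw [← this]
    simp [hw]
  have hle : ∀ t : Fin n → Fin B,
      (∏ i, w (t i)) * ENNReal.ofReal (3 / 4) ≤ (∏ i, w (t i)) * P.output (X t) E := by
    intro t
    by_cases ht : ∃ i, t i = u
    · obtain ⟨i, hi⟩ := ht
      rw [Finset.prod_eq_zero (Finset.mem_univ i) (by rw [hi, hwu])]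
      simp
    · push Not at ht
      gcongr
      have h1 := hacc (X t)
      norm_num at h1
      refine h1.trans (measure_mono fun ω hω => ?_)
      have h2 := hω u
      have h3 : frequency (X t) u = numTrue b / n := by
        have h4 : ∀ i, (if u = X t i then (1 : ℝ) else 0) = if b i then 1 else 0 := by
          intro i
          by_cases hb : b i = true
          · simp [hX, hb]
          · simp [hX, hb, (ht i).symm]
        rw [frequency, Finset.sum_congr rfl fun i _ => h4 i, numTrue]
        push_cast
        ring
      rw [h3] at h2
      change |(numTrue b : ℝ) - n * (ω u : ℝ)| ≤ n * α
      have h5 : (numTrue b : ℝ) - n * (ω u : ℝ) = -(n * ((ω u : ℝ) - numTrue b / n)) := by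
        field_simp; ring
      rw [h5, abs_neg, abs_mul, abs_of_pos hn']
      gcongr
  calc ENNReal.ofReal (3 / 4) = ∑ t : Fin n → Fin B, (∏ i, w (t i)) * ENNReal.ofReal (3 / 4) := by
        rw [← Finset.sum_mul, hone, one_mul]
    _ ≤ ∑ t : Fin n → Fin B, (∏ i, w (t i)) * P.output (X t) E := Finset.sum_le_sum fun t _ => hle t
    _ = ∑' y : Fin n → Y, ∑ t : Fin n → Fin B,
          (∏ i, w (t i)) * ((∏ i, P.randomizer (X t i) (y i)) * P.outputGiven y E) := by
        rw [Summable.tsum_finsetSum fun _ _ => ENNReal.summable]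
        refine Finset.sum_congr rfl fun t _ => ?_
        rw [output_apply P _ hEm, ENNReal.tsum_mul_left]
    _ = _ := by
        refine tsum_congr fun y => ?_
        simp only [← mul_assoc, ← Finset.sum_mul, ← Finset.prod_mul_distrib, hX]
        congr 1
        have := Finset.prod_univ_sum (fun _ : Fin n => (Finset.univ : Finset (Fin B)))
          (fun i v => w v * P.randomizer (if b i then u else v) (y i))
        rw [Fintype.piFinset_univ] at this
        rw [← this]
        refine Finset.prod_congr rfl fun i _ => ?_
        split_ifs
        · rw [← Finset.sum_mul, hw, one_mul]
        · rfl

theorem overlap_le {P : SingleMessageProtocol n B Y} {α : ℝ}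
    (hacc : IsAccurate α (1 / 4) P.output) (hn : 0 < n) {u v : Fin B} (huv : u ≠ v) :
    n * ∑' y, min (P.randomizer u y) (P.randomizer v y)
      ≤ ENNReal.ofReal (64 * (n * α + 1) ^ 2) := by
  have := overlap_mixture_le hacc hn u (Pi.single v 1) (by simp [huv]) (by simp)
  simpa [Pi.single_apply] using this

theorem output_eq_tsum_shuffled (P : SingleMessageProtocol n B Y) (X : Fin n → Fin B)
    {E : Set (Fin B → unitInterval)} (hE : MeasurableSet E) :
    P.output X E = ∑' z, P.shuffledMessages X z *
      (P.analyzer z : Measure (Fin B → unitInterval)) E := by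
  simp [output, Measure.sum_apply _ hE]

/-- Privacy alone forces an error of half an entry. -/
theorem half_le_mul_error {P : SingleMessageProtocol n B Y} {ε δ α : ℝ}
    (hdp : P.IsShuffledDP ε δ) (hacc : IsAccurate α (1 / 4) P.output) (hn : 0 < n) (hB : 2 ≤ B)
    (hε : ε ≤ 1) (hδ0 : 0 ≤ δ) (hδ : δ ≤ 1 / 20) : 1 / 2 ≤ n * α := by
  by_contra! hlt
  have hn' : (0 : ℝ) < n := by exact_mod_cast hn
  set a : Fin B := ⟨0, by omega⟩
  set b : Fin B := ⟨1, by omega⟩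
  have hab : a ≠ b := by simp [a, b]
  set i₀ : Fin n := ⟨0, hn⟩
  set X' : Fin n → Fin B := fun _ => a
  set X : Fin n → Fin B := Function.update X' i₀ b
  have hX : Neighboring X X' := ⟨1, 1, i₀, fun j hj => by simp [X, hj]⟩
  have hX' : frequency X' b = 0 := by simp [frequency, X', hab.symm]
  have hXb : frequency X b = 1 / n := by
    have : ∀ i, (if b = X i then (1 : ℝ) else 0) = if i = i₀ then 1 else 0 := by
      intro i
      by_cases hi : i = i₀
      · simp [X, hi]
      · simp [X, X', hi, hab.symm]
    rw [frequency, Finset.sum_congr rfl fun i _ => this i]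
    simp
  have hdisj := disjoint_accurate (α := α) (X := X) (X' := X') ⟨b, by
    rw [hXb, hX', sub_zero, abs_of_pos (by positivity), lt_div_iff₀ hn']; linarith⟩
  set E := {v : Fin B → unitInterval | ∀ j : Fin B, |(v j : ℝ) - frequency X j| ≤ α}
  set E' := {v : Fin B → unitInterval | ∀ j : Fin B, |(v j : ℝ) - frequency X' j| ≤ α}
  have hEm : MeasurableSet E := measurableSet_accurate α X
  have hEm' : MeasurableSet E' := measurableSet_accurate α X'
  have h1 : ENNReal.ofReal (1 - 1 / 4) ≤ P.output X E := hacc X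
  have h2 : ENNReal.ofReal (1 - 1 / 4) ≤ P.output X' E' := hacc X'
  have h3 : P.output X' E + P.output X' E' ≤ 1 := by
    rw [← measure_union hdisj hEm', ← P.output_univ X']
    exact measure_mono (Set.subset_univ _)
  have h4 : P.output X' E ≤ ENNReal.ofReal (1 / 4) := by
    refine (ENNReal.add_le_add_iff_right (a := ENNReal.ofReal (1 - 1 / 4)) (by simp)).mp ?_
    rw [← ENNReal.ofReal_add (by norm_num) (by norm_num)]
    norm_num at h2 h3 ⊢
    exact (by gcongr : _ ≤ P.output X' E + P.output X' E').trans h3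
  have h5 := IsDP.tsum_mul_le hdp hX
    (fun z => (P.analyzer z : Measure (Fin B → unitInterval)) E) (fun z => prob_le_one)
  rw [← output_eq_tsum_shuffled P X hEm, ← output_eq_tsum_shuffled P X' hEm] at h5
  have h6 : ENNReal.ofReal (1 - 1 / 4) ≤ ENNReal.ofReal (Real.exp ε * (1 / 4) + δ) := by
    refine (h1.trans h5).trans ?_
    rw [ENNReal.ofReal_add (by positivity) hδ0, ENNReal.ofReal_mul (Real.exp_pos _).le]
    gcongr
  have h0 := Real.exp_pos ε
  rw [ENNReal.ofReal_le_ofReal_iff (by positivity)] at h6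
  have h7 : Real.exp ε ≤ Real.exp 1 := Real.exp_le_exp.mpr hε
  -- The contradiction is `e / 4 + 1 / 20 < 3 / 4`.
  linarith [Real.exp_one_lt_d9]

end SingleMessageProtocol

/-! ### The error grows with the square root of the number of items -/

/-- A sum of finitely many terms exceeds a common bound by at most their pairwise minima. -/
theorem Finset.sum_le_add_sum_offDiag_min {ι : Type*} [DecidableEq ι] (V : Finset ι)
    (a : ι → ℝ≥0∞) (M : ℝ≥0∞) (hM : ∀ v ∈ V, a v ≤ M) :
    ∑ v ∈ V, a v ≤ M + ∑ p ∈ V.offDiag, min (a p.1) (a p.2) := by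
  rcases V.eq_empty_or_nonempty with rfl | hne
  · simp
  obtain ⟨v₀, hv₀, hmax⟩ := V.exists_max_image a hne
  rw [← Finset.add_sum_erase V a hv₀]
  refine add_le_add (hM v₀ hv₀) ?_
  calc ∑ v ∈ V.erase v₀, a v = ∑ p ∈ (V.erase v₀).image (fun v => (v, v₀)), min (a p.1) (a p.2) := by
        rw [Finset.sum_image (fun x _ y _ h => (Prod.mk.inj h).1)]
        exact Finset.sum_congr rfl fun v hv => (min_eq_left (hmax v (Finset.mem_of_mem_erase hv))).symm
    _ ≤ _ := by
        refine Finset.sum_le_sum_of_subset fun p hp => ?_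
        obtain ⟨v, hv, rfl⟩ := Finset.mem_image.mp hp
        simp [Finset.mem_offDiag, Finset.mem_of_mem_erase hv, hv₀, Finset.ne_of_mem_erase hv]

namespace SingleMessageProtocol

variable {n B : ℕ} {Y : Type*}

/-- With at most `√n + 1` items, the squared error is at least proportional to their number. -/
theorem card_le_error_sq {P : SingleMessageProtocol n B Y} {ε δ α : ℝ}
    (hdp : P.IsShuffledDP ε δ) (hacc : IsAccurate α (1 / 4) P.output) (hn : 0 < n)
    (hε : ε ≤ 1) (hδ0 : 0 ≤ δ) (hδ : δ ≤ 1 / 2) (u : Fin B) (V : Finset (Fin B)) (hu : u ∉ V)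
    (hV : V.card ^ 2 ≤ n) : (V.card : ℝ) ≤ 512 * (n * α + 1) ^ 2 := by
  rcases V.eq_empty_or_nonempty with rfl | hne
  · simp; positivity
  have hc : 0 < V.card := hne.card_pos
  have hc0 : (V.card : ℝ≥0∞) ≠ 0 := by exact_mod_cast hc.ne'
  have hct : (V.card : ℝ≥0∞) ≠ ∞ := ENNReal.natCast_ne_top _
  set D : ℝ≥0∞ := ENNReal.ofReal (64 * (n * α + 1) ^ 2)
  set L : ℝ≥0∞ := ENNReal.ofReal (Real.exp ε) * n with hL
  -- One factor serving both arguments of the minimum: it dominates `e ^ ε * n` against `R(u)`, and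
  -- `V.card` against the uniform mixture.
  set L' : ℝ≥0∞ := 3 * n with hL'
  have hLL : L ≤ L' := by
    rw [hL, hL']
    gcongr
    rw [← ENNReal.ofReal_ofNat]
    refine ENNReal.ofReal_le_ofReal ?_
    linarith [Real.exp_le_exp.mpr hε, Real.exp_one_lt_d9]
  have hcL : (V.card : ℝ≥0∞) ≤ L' := by
    rw [hL']
    have : V.card ≤ 3 * n := by nlinarith
    exact_mod_cast this
  set w : Fin B → ℝ≥0∞ := fun v => if v ∈ V then (V.card : ℝ≥0∞)⁻¹ else 0 with hw
  have hmix := overlap_mixture_le hacc hn u w (by simp [hw, hu])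
    (by simp [hw, ENNReal.mul_inv_cancel hc0 hct])
  set θ : ℝ≥0∞ := ∑' y, min (P.randomizer u y) (∑ v, w v * P.randomizer v y)
  set r : Fin B → Y → ℝ≥0∞ := fun v y => min (P.randomizer v y) (L * P.randomizer u y) with hr
  have hpoint : ∀ y, ∑ v ∈ V, r v y
      ≤ L' * min (P.randomizer u y) (∑ v, w v * P.randomizer v y)
        + ∑ p ∈ V.offDiag, min (P.randomizer p.1 y) (P.randomizer p.2 y) := by
    intro y
    refine (Finset.sum_le_add_sum_offDiag_min V (fun v => r v y) _ fun v hv => ?_).trans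
      (add_le_add_right (Finset.sum_le_sum fun p _ =>
        min_le_min (min_le_left _ _) (min_le_left _ _)) _)
    rw [mul_min]
    refine le_min ((min_le_right _ _).trans (by gcongr)) ((min_le_left _ _).trans ?_)
    calc P.randomizer v y = V.card * (w v * P.randomizer v y) := by
          rw [← mul_assoc]
          simp [hw, hv, ENNReal.mul_inv_cancel hc0 hct]
      _ ≤ L' * ∑ v, w v * P.randomizer v y := by
          gcongr
          exact Finset.single_le_sum (f := fun v => w v * P.randomizer v y)
            (fun _ _ => zero_le) (Finset.mem_univ v)
  have hsum : (V.card : ℝ≥0∞) ≤ L' * θ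
      + ∑ p ∈ V.offDiag, ∑' y, min (P.randomizer p.1 y) (P.randomizer p.2 y)
      + V.card * ENNReal.ofReal δ := by
    calc (V.card : ℝ≥0∞) = ∑ v ∈ V, 1 := by simp
      _ ≤ ∑ v ∈ V, (∑' y, r v y + ENNReal.ofReal δ) :=
          Finset.sum_le_sum fun v _ => hdp.one_le_tsum_min_add hn v u
      _ = ∑' y, ∑ v ∈ V, r v y + V.card * ENNReal.ofReal δ := by
          rw [Finset.sum_add_distrib, Summable.tsum_finsetSum fun _ _ => ENNReal.summable]
          simp
      _ ≤ _ := by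
          gcongr
          refine (ENNReal.tsum_le_tsum hpoint).trans_eq ?_
          rw [ENNReal.tsum_add, ENNReal.tsum_mul_left,
            Summable.tsum_finsetSum fun _ _ => ENNReal.summable]
  have hoff : ∑ p ∈ V.offDiag, ∑' y, min (P.randomizer p.1 y) (P.randomizer p.2 y) ≤ D := by
    have hn0 : (n : ℝ≥0∞) ≠ 0 := by exact_mod_cast hn.ne'
    refine (ENNReal.mul_le_mul_iff_right hn0 (ENNReal.natCast_ne_top n)).mp ?_
    rw [Finset.mul_sum]
    calc _ ≤ ∑ p ∈ V.offDiag, D := Finset.sum_le_sum fun p hp =>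
          overlap_le hacc hn (Finset.mem_offDiag.mp hp).2.2
      _ = V.offDiag.card * D := by simp
      _ ≤ n * D := by
          -- The hypothesis `V.card ^ 2 ≤ n` enters here: the number of ordered pairs is at most
          -- `n`, cancelling the `1 / n` in each overlap bound.
          gcongr
          rw [Finset.offDiag_card]
          exact (Nat.sub_le _ _).trans (by nlinarith)
  have hmix' : L' * θ ≤ 3 * D := by
    rw [hL', mul_assoc]
    gcongr
  have hfin : ENNReal.ofReal V.card
      ≤ ENNReal.ofReal (256 * (n * α + 1) ^ 2 + V.card * δ) := by
    rw [ENNReal.ofReal_natCast]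
    refine hsum.trans ((add_le_add_left (add_le_add hmix' hoff) _).trans_eq ?_)
    rw [ENNReal.ofReal_add (by positivity) (by positivity),
      ENNReal.ofReal_mul (Nat.cast_nonneg _), ENNReal.ofReal_natCast,
      show 256 * ((n : ℝ) * α + 1) ^ 2 = 4 * (64 * (n * α + 1) ^ 2) by ring,
      ENNReal.ofReal_mul (p := 4) (by norm_num), ENNReal.ofReal_ofNat]
    ring
  rw [ENNReal.ofReal_le_ofReal_iff (by positivity)] at hfin
  have : (V.card : ℝ) * δ ≤ V.card * (1 / 2) := by gcongr
  linarith

/-- The error is at least proportional to the square root of the number of items, as long as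
there are at most `√n` of them. -/
theorem items_le_error_sq {P : SingleMessageProtocol n B Y} {ε δ α : ℝ}
    (hdp : P.IsShuffledDP ε δ) (hacc : IsAccurate α (1 / 4) P.output) (hn : 0 < n) (hB : 2 ≤ B)
    (hε : ε ≤ 1) (hδ0 : 0 ≤ δ) (hδ : δ ≤ 1 / 20) (m : ℕ) (hm : m ≤ B) (hmn : m ^ 2 ≤ n) :
    (m : ℝ) ≤ 5000 * (n * α) ^ 2 := by
  have hhalf := half_le_mul_error hdp hacc hn hB hε hδ0 hδ
  rcases Nat.eq_zero_or_pos m with rfl | hm0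
  · simp; positivity
  set V : Finset (Fin B) := Finset.univ.filter fun v => 0 < v.val ∧ v.val < m with hVdef
  have hVc : V.card = m - 1 := by
    rw [hVdef, ← Finset.card_map Fin.valEmbedding]
    have : (Finset.univ.filter fun v : Fin B => 0 < v.val ∧ v.val < m).map Fin.valEmbedding
        = Finset.Ioo 0 m := by
      ext k
      simp only [Finset.mem_map, Finset.mem_filter, Finset.mem_univ, true_and,
        Fin.valEmbedding_apply, Finset.mem_Ioo]
      exact ⟨fun ⟨v, hv, hk⟩ => hk ▸ hv, fun hk => ⟨⟨k, hk.2.trans_le hm⟩, hk, rfl⟩⟩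
    rw [this, Nat.card_Ioo, Nat.sub_zero]
  have h := card_le_error_sq hdp hacc hn hε hδ0 (by linarith) ⟨0, by omega⟩ V (by simp [hVdef])
    (by rw [hVc]; exact (Nat.pow_le_pow_left (Nat.sub_le m 1) 2).trans hmn)
  rw [hVc, Nat.cast_sub hm0, Nat.cast_one] at h
  -- The bound `1 / 2 ≤ n * α` absorbs the additive 1 here, and also the item lost to `u`.
  have : (n * α + 1) ^ 2 ≤ (3 * (n * α)) ^ 2 := by gcongr; linarith
  nlinarith

end SingleMessageProtocol

/-! ### The packing bound -/

namespace SingleMessageProtocol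

variable {n B : ℕ} {Y : Type*}

/-- Packing bound: if `k` users suffice to make an item's frequency stand out from the error, then
the messages of `k` users must be able to identify any of the items. -/
theorem items_le_pow {P : SingleMessageProtocol n B Y} {ε δ α : ℝ}
    (hdp : P.IsShuffledDP ε δ) (hacc : IsAccurate α (1 / 4) P.output) (hn : 0 < n) (hB : 0 < B)
    (hδ0 : 0 ≤ δ) (hδ1 : δ ≤ 1) (k : ℕ) (hkn : k ≤ n) (hkδ : k * δ ≤ 1 / 4) (hk : 2 * (n * α) < k) :
    ((B : ℝ) - 1) / 2 ≤ (Real.exp ε * n) ^ k := by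
  have hn' : (0 : ℝ) < n := by exact_mod_cast hn
  set u : Fin B := ⟨0, hB⟩
  set L : ℝ≥0∞ := ENNReal.ofReal (Real.exp ε) * n with hL
  set X : Fin B → Fin n → Fin B := fun v i => if i.val < k then v else u with hX
  set X₀ : Fin n → Fin B := fun _ => u
  set E : Fin B → Set (Fin B → unitInterval) :=
    fun v => {ω | ∀ j : Fin B, |(ω j : ℝ) - frequency (X v) j| ≤ α}
  have hEm : ∀ v, MeasurableSet (E v) := fun v => measurableSet_accurate α (X v)
  have hcard : (Finset.univ.filter fun i : Fin n => i.val < k).card = k := by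
    rw [← Finset.card_map Fin.valEmbedding]
    have : (Finset.univ.filter fun i : Fin n => i.val < k).map Fin.valEmbedding
        = Finset.range k := by
      ext j
      simp only [Finset.mem_map, Finset.mem_filter, Finset.mem_univ, true_and,
        Fin.valEmbedding_apply, Finset.mem_range]
      exact ⟨fun ⟨v, hv, hk⟩ => hk ▸ hv, fun hk => ⟨⟨j, hk.trans_le hkn⟩, hk, rfl⟩⟩
    rw [this, Finset.card_range]
  have hfreq : ∀ v ≠ u, frequency (X v) v = k / n := by
    intro v hv
    have : ∀ i, (if v = X v i then (1 : ℝ) else 0) = if i.val < k then 1 else 0 := by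
      intro i
      by_cases hi : i.val < k <;> simp [hX, hi, hv]
    rw [frequency, Finset.sum_congr rfl fun i _ => this i, Finset.sum_boole, hcard]
    ring
  have hfreq' : ∀ v w, w ≠ u → w ≠ v → frequency (X v) w = 0 := by
    intro v w hwu hwv
    have : ∀ i, (if w = X v i then (1 : ℝ) else 0) = 0 := by
      intro i
      by_cases hi : i.val < k <;> simp [hX, hi, hwu, hwv]
    simp [frequency, this]
  have hdisj : ∀ v ∈ Finset.univ.erase u, ∀ w ∈ Finset.univ.erase u, v ≠ w →
      Disjoint (E v) (E w) := by
    intro v hv w _ hvw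
    have hvu := Finset.ne_of_mem_erase hv
    refine disjoint_accurate ⟨v, ?_⟩
    rw [hfreq v hvu, hfreq' w v hvu hvw, sub_zero, abs_of_nonneg (by positivity), lt_div_iff₀ hn']
    linarith
  have hone : ∀ v ∈ Finset.univ.erase u, ENNReal.ofReal (1 / 2) ≤ L ^ k * P.output X₀ (E v) := by
    intro v _
    set s : Y → ℝ≥0∞ := fun y => min (P.randomizer v y) (L * P.randomizer u y) with hs
    have hsmass : ENNReal.ofReal (1 - δ) ≤ ∑' y, s y := by
      rw [ENNReal.ofReal_sub _ hδ0, ENNReal.ofReal_one]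
      exact tsub_le_iff_right.mpr (hdp.one_le_tsum_min_add hn v u)
    -- Truncate only the `k` planted coordinates: `r` keeps mass at least `(1 - δ) ^ k`, yet is at
    -- most `L ^ k` times the law for `X₀`.
    set r : (Fin n → Y) → ℝ≥0∞ :=
      fun y => ∏ i, if i.val < k then s (y i) else P.randomizer u (y i) with hr
    have hcmp := tsum_mul_add_tsum_le (fun y : Fin n → Y => ∏ i, P.randomizer (X v i) (y i)) r
      (fun y => P.outputGiven y (E v)) (fun y => Finset.prod_le_prod' fun i _ => by
        by_cases hi : i.val < k
        · simp [hX, hi, hs]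
        · simp [hX, hi]) (fun y => prob_le_one)
    rw [← output_apply P _ (hEm v), tsum_prod_pmf_eq_one] at hcmp
    have hrsum : ENNReal.ofReal (3 / 4) ≤ ∑' y, r y := by
      have h1 : ∑' y, r y = (∑' z, s z) ^ k := by
        have := ENNReal.tsum_pi_prod n
          (fun (i : Fin n) z => if i.val < k then s z else P.randomizer u z)
        rw [hr]
        simp only at this ⊢
        rw [this]
        have h2 : ∀ i : Fin n, ∑' z, (if i.val < k then s z else P.randomizer u z)
            = if i.val < k then ∑' z, s z else 1 := by
          intro i
          split_ifs
          · rfl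
          · exact (P.randomizer u).tsum_coe
        rw [Finset.prod_congr rfl fun i _ => h2 i, Finset.prod_ite, Finset.prod_const,
          Finset.prod_const_one, hcard, mul_one]
      rw [h1]
      calc ENNReal.ofReal (3 / 4) ≤ ENNReal.ofReal ((1 - δ) ^ k) := by
            refine ENNReal.ofReal_le_ofReal ?_
            have := one_add_mul_le_pow (a := -δ) (by linarith) k
            rw [← sub_eq_add_neg] at this
            linarith
        _ = ENNReal.ofReal (1 - δ) ^ k := ENNReal.ofReal_pow (by linarith) k
        _ ≤ _ := by gcongr
    have hrg : ∑' y, r y * P.outputGiven y (E v) ≤ L ^ k * P.output X₀ (E v) := by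
      rw [output_apply P _ (hEm v), ← ENNReal.tsum_mul_left]
      refine ENNReal.tsum_le_tsum fun y => ?_
      rw [← mul_assoc]
      gcongr
      calc r y ≤ ∏ i : Fin n, (if i.val < k then L else 1) * P.randomizer u (y i) := by
            refine Finset.prod_le_prod' fun i _ => ?_
            split_ifs
            · exact min_le_right _ _
            · rw [one_mul]
        _ = _ := by
            rw [Finset.prod_mul_distrib, Finset.prod_ite, Finset.prod_const,
              Finset.prod_const_one, hcard, mul_one]
    refine (ENNReal.add_le_add_iff_right ENNReal.one_ne_top).mp ?_
    have h34 : ENNReal.ofReal (3 / 4) ≤ P.output (X v) (E v) := by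
      have := hacc (X v)
      norm_num at this ⊢
      exact this
    calc ENNReal.ofReal (1 / 2) + 1 = ENNReal.ofReal (3 / 4) + ENNReal.ofReal (3 / 4) := by
          rw [← ENNReal.ofReal_one, ← ENNReal.ofReal_add (by norm_num) (by norm_num),
            ← ENNReal.ofReal_add (by norm_num) (by norm_num)]
          norm_num
      _ ≤ P.output (X v) (E v) + ∑' y, r y := add_le_add h34 hrsum
      _ ≤ _ := hcmp
      _ ≤ _ := by gcongr
  have hsum : ((B - 1 : ℕ) : ℝ≥0∞) * ENNReal.ofReal (1 / 2) ≤ L ^ k := by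
    calc _ = ∑ _v ∈ Finset.univ.erase u, ENNReal.ofReal (1 / 2) := by
          rw [Finset.sum_const, Finset.card_erase_of_mem (Finset.mem_univ u), Finset.card_univ,
            Fintype.card_fin, nsmul_eq_mul]
      _ ≤ ∑ v ∈ Finset.univ.erase u, L ^ k * P.output X₀ (E v) := Finset.sum_le_sum hone
      _ = L ^ k * P.output X₀ (⋃ v ∈ Finset.univ.erase u, E v) := by
          rw [← Finset.mul_sum, measure_biUnion_finset hdisj fun v _ => hEm v]
      _ ≤ L ^ k * 1 := by
          gcongr
          rw [← P.output_univ X₀]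
          exact measure_mono (Set.subset_univ _)
      _ = L ^ k := mul_one _
  rw [hL, ← ENNReal.ofReal_natCast n, ← ENNReal.ofReal_mul (Real.exp_pos ε).le,
    ← ENNReal.ofReal_pow (by positivity), ← ENNReal.ofReal_natCast,
    ← ENNReal.ofReal_mul (Nat.cast_nonneg _), ENNReal.ofReal_le_ofReal_iff (by positivity),
    Nat.cast_sub hB, Nat.cast_one] at hsum
  linarith

end SingleMessageProtocol

/-! ### From the structural bounds to the three regimes -/

/-- The tangent line of the logarithm at `1024`, using `1 / log 2 < 2`. -/
theorem Real.logb_two_le_add_div {x : ℝ} (hx : 0 < x) : Real.logb 2 x ≤ 10 + x / 512 := by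
  have h2 := Real.log_two_gt_d9
  have h1 : Real.log (x / 1024) ≤ x / 1024 - 1 := Real.log_le_sub_one_of_pos (by positivity)
  rw [Real.log_div hx.ne' (by norm_num), show (1024 : ℝ) = 2 ^ 10 by norm_num, Real.log_pow] at h1
  rw [Real.logb, div_le_iff₀ (by linarith)]
  push_cast at h1
  nlinarith

/-- A choice of `k` users contradicts the packing bound if the error is too small. -/
theorem small_sample_error_lower_bound {n B : ℕ} (hn : (2 : ℝ) ^ 30 ≤ n) {ε α : ℝ} (hα : 0 ≤ α)
    (hε : ε ≤ Real.logb 2 n) (hB : 2 ≤ B)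
    (hlow : Real.logb 2 B / Real.logb 2 (Real.logb 2 B) ≤ n)
    (hup : (n : ℝ) ≤ Real.logb 2 B ^ 2 * Real.logb 2 (Real.logb 2 B))
    (hpack : ∀ k : ℕ, k ≤ n → 2 * (n * α) < k → ((B : ℝ) - 1) / 2 ≤ (Real.exp ε * n) ^ k) :
    1 / 200 * (Real.logb 2 B / (n * Real.logb 2 (Real.logb 2 B))) ≤ α := by
  have hn0 : (0 : ℝ) < n := lt_of_lt_of_le (by norm_num) hn
  have hB2 : (2 : ℝ) ≤ B := by exact_mod_cast hB
  set l := Real.logb 2 B with hl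
  set lam := Real.logb 2 l with hlam
  have hl1 : 1 ≤ l := by
    rw [hl, Real.le_logb_iff_rpow_le one_lt_two (by linarith)]
    simpa using hB2
  have hlam0 : 0 < lam := by
    by_contra! h
    nlinarith [mul_nonneg (sq_nonneg l) (neg_nonneg.mpr h)]
  have hlaml := Real.logb_two_le_add_div (x := l) (by linarith)
  have hlaml' : lam ≤ l := by
    have h1 : l < 2 ^ l := by
      have h2 : Real.log l ≤ l - 1 := Real.log_le_sub_one_of_pos (by linarith)
      have h3 := one_add_mul_self_le_rpow_one_add (s := 1) (by norm_num) hl1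
      norm_num at h3
      linarith
    rw [hlam, Real.logb_le_iff_le_rpow one_lt_two (by linarith)]
    exact h1.le
  -- Besides giving `logb 2 n ≤ 3 * lam`, this turns the size of `n` into `l ≥ 1024`.
  have hn3 : (n : ℝ) ≤ l ^ 3 := hup.trans (by nlinarith [sq_nonneg l])
  have hl1024 : (1024 : ℝ) ≤ l := by
    refine le_of_pow_le_pow_left₀ (n := 3) (by norm_num) (by linarith) ?_
    calc (1024 : ℝ) ^ 3 = 2 ^ 30 := by norm_num
      _ ≤ l ^ 3 := hn.trans hn3
  by_contra! hlt
  have hαn : n * α < 1 / 200 * (l / lam) := by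
    have : n * α < n * (1 / 200 * (l / (n * lam))) := by gcongr
    calc n * α < _ := this
      _ = 1 / 200 * (l / lam) := by field_simp
  -- The least integer exceeding `2 * (n * α)`, strictness being what keeps the packed events
  -- disjoint.
  set k := ⌊2 * (n * α)⌋₊ + 1 with hk
  have hk1 : 2 * (n * α) < k := by rw [hk]; push_cast; exact Nat.lt_floor_add_one _
  have hk2 : (k : ℝ) ≤ 2 * (n * α) + 1 := by
    rw [hk]; push_cast; gcongr; exact Nat.floor_le (by positivity)
  have hkn : k ≤ n := by
    have : (k : ℝ) ≤ n := by linarith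
    exact_mod_cast this
  have h1 := hpack k hkn hk1
  -- The hypothesis on `ε` uses the base-2 logarithm, which is at most twice the natural one.
  have hexp : Real.exp ε ≤ (n : ℝ) ^ 2 := by
    calc Real.exp ε ≤ Real.exp (2 * Real.log n) := by
          refine Real.exp_le_exp.mpr (hε.trans ?_)
          have := Real.log_two_gt_d9
          have h0 : 0 ≤ Real.log n := Real.log_natCast_nonneg n
          rw [Real.logb, div_le_iff₀ (by linarith)]
          nlinarith
      _ = (n : ℝ) ^ 2 := by
          rw [show 2 * Real.log n = ((2 : ℕ) : ℝ) * Real.log n by norm_num, Real.exp_nat_mul,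
            Real.exp_log hn0]
  have h2 : (B : ℝ) / 4 ≤ (n : ℝ) ^ (3 * k) := by
    calc (B : ℝ) / 4 ≤ ((B : ℝ) - 1) / 2 := by linarith
      _ ≤ _ := h1
      _ ≤ ((n : ℝ) ^ 2 * n) ^ k := by gcongr
      _ = (n : ℝ) ^ (3 * k) := by rw [pow_mul]; ring
  have h3 : l - 2 ≤ 3 * k * Real.logb 2 n := by
    have := Real.logb_le_logb_of_le one_lt_two (by positivity) h2
    rw [Real.logb_div (by positivity) (by norm_num), Real.logb_pow,
      show (4 : ℝ) = 2 ^ 2 by norm_num, Real.logb_pow,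
      Real.logb_self_eq_one one_lt_two] at this
    push_cast at this
    linarith
  have h4 : Real.logb 2 n ≤ 3 * lam := by
    have := Real.logb_le_logb_of_le one_lt_two hn0 hn3
    rw [Real.logb_pow] at this
    exact_mod_cast this
  have h5 : (k : ℝ) * lam ≤ l / 100 + lam := by
    have : (k : ℝ) ≤ l / lam / 100 + 1 := by linarith
    calc (k : ℝ) * lam ≤ (l / lam / 100 + 1) * lam := by gcongr
      _ = l / 100 + lam := by field_simp
  have h6 : 3 * (k : ℝ) * Real.logb 2 n ≤ 3 * k * (3 * lam) := by gcongr
  -- Altogether `l - 2 ≤ 9 * (l / 100 + lam)` with `lam ≤ 10 + l / 512`, impossible for `l ≥ 1024`.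
  linarith

theorem Nat.half_sqrt_le (n : ℕ) (hn : 1 ≤ n) : √(n : ℝ) / 2 ≤ Nat.sqrt n := by
  have h1 : 1 ≤ Nat.sqrt n := Nat.sqrt_pos.mpr hn
  have h2 : √(n : ℝ) ≤ Nat.sqrt n + 1 := by
    rw [Real.sqrt_le_left (by positivity)]
    exact_mod_cast (Nat.lt_succ_sqrt' n).le
  have h3 : (1 : ℝ) ≤ Nat.sqrt n := by exact_mod_cast h1
  linarith

/-- With `m = Nat.sqrt n`, allowed because `n ≤ B ^ 2`, one gets `n α ≥ n ^ (1/4) / 100`. This is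
stronger than needed, as the logarithmic factor is at least 1. -/
theorem intermediate_sample_error_lower_bound {n B : ℕ} (hn : 2 ≤ n) (hB : 2 ≤ B) {α : ℝ}
    (hα : 0 ≤ α) (hup : (n : ℝ) ≤ (B : ℝ) ^ 2 / Real.logb 2 B)
    (h : ∀ m : ℕ, m ≤ B → m ^ 2 ≤ n → (m : ℝ) ≤ 5000 * (n * α) ^ 2) :
    1 / 200 * (1 / ((n : ℝ) ^ (3 / 4 : ℝ) * Real.logb 2 n ^ (1 / 4 : ℝ))) ≤ α := by
  have hn2 : (2 : ℝ) ≤ n := by exact_mod_cast hn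
  have hn0 : (0 : ℝ) < n := by linarith
  have hB2 : (2 : ℝ) ≤ B := by exact_mod_cast hB
  have hlog : ∀ x : ℝ, 2 ≤ x → 1 ≤ Real.logb 2 x := fun x hx => by
    rw [Real.le_logb_iff_rpow_le one_lt_two (by linarith)]
    simpa using hx
  have hnB : n ≤ B ^ 2 := by
    have : (n : ℝ) ≤ (B : ℝ) ^ 2 := hup.trans (div_le_self (by positivity) (hlog _ hB2))
    exact_mod_cast this
  have hm := h (Nat.sqrt n) (by
    rw [← Nat.sqrt_eq' B]; exact Nat.sqrt_le_sqrt hnB) (Nat.sqrt_le' n)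
  have hs := Nat.half_sqrt_le n (by omega)
  have hroot : (n : ℝ) ^ (1 / 4 : ℝ) / 100 ≤ n * α := by
    refine le_of_sq_le_sq ?_ (by positivity)
    have : ((n : ℝ) ^ (1 / 4 : ℝ)) ^ 2 = √n := by
      rw [← Real.rpow_natCast, ← Real.rpow_mul hn0.le, Real.sqrt_eq_rpow]
      norm_num
    rw [div_pow, this]
    linarith
  have hlogn : 1 ≤ Real.logb 2 n ^ (1 / 4 : ℝ) :=
    Real.one_le_rpow (hlog _ hn2) (by norm_num)
  have hsplit : (n : ℝ) = (n : ℝ) ^ (1 / 4 : ℝ) * (n : ℝ) ^ (3 / 4 : ℝ) := by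
    rw [← Real.rpow_add hn0]; norm_num
  have hpos : 0 < (n : ℝ) ^ (3 / 4 : ℝ) := by positivity
  have hpos' : 0 < (n : ℝ) ^ (1 / 4 : ℝ) := by positivity
  calc 1 / 200 * (1 / ((n : ℝ) ^ (3 / 4 : ℝ) * Real.logb 2 n ^ (1 / 4 : ℝ)))
      ≤ 1 / 100 * (1 / ((n : ℝ) ^ (3 / 4 : ℝ) * 1)) := by gcongr; norm_num
    _ ≤ α := by
      rw [mul_one, mul_one_div, div_le_iff₀ hpos]
      refine le_of_mul_le_mul_left ?_ hpos'
      calc (n : ℝ) ^ (1 / 4 : ℝ) * (1 / 100) ≤ n * α := by linarith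
        _ = (n : ℝ) ^ (1 / 4 : ℝ) * (α * (n : ℝ) ^ (3 / 4 : ℝ)) := by
          nth_rewrite 1 [hsplit]; ring

/-- Uses `m = min B (Nat.sqrt n)`. When `√n` is the smaller one, the lower bound on `n` still gives
`√n ≥ B / logb 2 B`. -/
theorem large_sample_error_lower_bound {n B : ℕ} (hn : 1 ≤ n) (hB : 2 ≤ B) {α : ℝ}
    (hα : 0 ≤ α) (hlow : (B : ℝ) ^ 2 / Real.logb 2 B < n)
    (h : ∀ m : ℕ, m ≤ B → m ^ 2 ≤ n → (m : ℝ) ≤ 5000 * (n * α) ^ 2) :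
    1 / 200 * (√(B : ℝ) / (n * √(Real.logb 2 B))) ≤ α := by
  have hn0 : (0 : ℝ) < n := by exact_mod_cast hn
  have hB2 : (2 : ℝ) ≤ B := by exact_mod_cast hB
  set l := Real.logb 2 B with hl
  have hl1 : 1 ≤ l := by
    rw [hl, Real.le_logb_iff_rpow_le one_lt_two (by linarith)]
    simpa using hB2
  have hkey : (B : ℝ) / l / 2 ≤ 5000 * (n * α) ^ 2 := by
    have hBl : (B : ℝ) / l ≤ B := div_le_self (by positivity) hl1
    rcases le_total B (Nat.sqrt n) with hle | hle
    · have := h B le_rfl ((Nat.pow_le_pow_left hle 2).trans (Nat.sqrt_le' n))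
      have h0 : 0 ≤ (B : ℝ) / l := by positivity
      linarith
    · have h1 := h (Nat.sqrt n) hle (Nat.sqrt_le' n)
      have h2 := Nat.half_sqrt_le n hn
      have h3 : (B : ℝ) / l ≤ √n := by
        refine Real.le_sqrt_of_sq_le (le_trans ?_ hlow.le)
        rw [div_pow]
        gcongr
        nlinarith
      linarith
  have hroot : √(B : ℝ) / √l / 200 ≤ n * α := by
    refine le_of_sq_le_sq ?_ (by positivity)
    rw [div_pow, div_pow, Real.sq_sqrt (by positivity), Real.sq_sqrt (by positivity)]
    have h0 : 0 ≤ (B : ℝ) / l := by positivity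
    linarith
  refine le_of_mul_le_mul_left (le_trans (le_of_eq ?_) hroot) hn0
  field_simp

theorem theorem3p2 :
    ∃ c : ℝ, 0 < c ∧ ∃ κ : ℝ, 0 < κ ∧
      ∀ (n B : ℕ), 1 / c ≤ (n : ℝ) → 2 ≤ B →
      ∀ (ε δ α : ℝ), 0 ≤ ε → 0 ≤ δ → δ < c / n →
      ∀ (Y : Type*) (P : SingleMessageProtocol n B Y),
        P.IsShuffledDP ε δ → IsAccurate α (1 / 4) P.output →
        -- small-sample regime
        (ε ≤ Real.logb 2 n →
          Real.logb 2 B / (c * Real.logb 2 (Real.logb 2 B)) ≤ n →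
          (n : ℝ) ≤ Real.logb 2 B ^ 2 * Real.logb 2 (Real.logb 2 B) →
          κ * (Real.logb 2 B / (n * Real.logb 2 (Real.logb 2 B))) ≤ α) ∧
        -- intermediate-sample regime
        (ε ≤ 1 →
          Real.logb 2 B ^ 2 * Real.logb 2 (Real.logb 2 B) ≤ n →
          (n : ℝ) ≤ (B : ℝ) ^ 2 / Real.logb 2 B →
          κ * (1 / ((n : ℝ) ^ (3 / 4 : ℝ) * Real.logb 2 n ^ (1 / 4 : ℝ))) ≤ α) ∧
        -- large-sample regime
        (ε ≤ 1 →
          (B : ℝ) ^ 2 / Real.logb 2 B < n →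
          κ * (√(B : ℝ) / (n * √(Real.logb 2 B))) ≤ α) := by
  -- This `c` forces `n ≥ 2 ^ 30 = 1024 ^ 3`, the threshold for `l ≥ 1024` in the small regime, and
  -- makes `n * δ` small enough for every use.
  refine ⟨1 / 2 ^ 30, by positivity, 1 / 200, by norm_num, ?_⟩
  intro n B hn hB ε δ α _ hδ0 hδ Y P hdp hacc
  rw [one_div_one_div] at hn
  have hn0 : (0 : ℝ) < n := lt_of_lt_of_le (by norm_num) hn
  have hn2 : 2 ≤ n := by
    have : (2 : ℝ) ≤ n := le_trans (by norm_num) hn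
    exact_mod_cast this
  have hα : 0 ≤ α := hacc.nonneg ⟨0, by omega⟩
  have hnδ : n * δ ≤ 1 / 2 ^ 30 := by
    rw [lt_div_iff₀ hn0] at hδ
    linarith
  have hδ1 : δ ≤ 1 / 20 := by
    have : 1 * δ ≤ n * δ := by
      gcongr
      exact_mod_cast (by omega : 1 ≤ n)
    norm_num at hnδ
    linarith
  have hitems : ε ≤ 1 → ∀ m : ℕ, m ≤ B → m ^ 2 ≤ n → (m : ℝ) ≤ 5000 * (n * α) ^ 2 :=
    fun hε => SingleMessageProtocol.items_le_error_sq hdp hacc (by omega) hB hε hδ0 hδ1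
  refine ⟨fun hε hlow hup => ?_, fun hε _ hup => ?_, fun hε hlow => ?_⟩
  · refine small_sample_error_lower_bound hn hα hε hB ?_ hup fun k hkn hk =>
      SingleMessageProtocol.items_le_pow hdp hacc (by omega) (by omega) hδ0 (by linarith) k hkn ?_ hk
    · rw [mul_comm, ← div_div, div_le_iff₀ (by positivity)] at hlow
      refine hlow.trans ?_
      linarith
    · have : k * δ ≤ n * δ := by gcongr
      norm_num at hnδ
      linarith
  · exact intermediate_sample_error_lower_bound hn2 hB hα hup (hitems hε)
  · exact large_sample_error_lower_bound (by omega) hB hα hlow (hitems hε)
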